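/- Let the Earth be a sphere of radius $r_{\mathrm e}>0$ centered at the origin $O$ of $\mathbb R^3$. For a point $p$ of the sphere and an angle $\theta$, let $S(p,\theta)$ be the spherical cap of all points of the sphere whose central angle to $p$ (the angle at $O$) is at most $\theta$. Let $C$ be a point of the sphere, $0<\theta_c<\pi/2$, and let a satellite at altitude $h>0$ have radial projection $P_t$ onto the sphere; let $\theta_v\in[0,\pi]$ be the central angle between $P_t$ and $C$. Let a user be distributed uniformly (with respect to surface area) on the cell $S(C,\theta_c)$, and let $\Upsilon_t$ be the central angle between the satellite (equivalently, $P_t$) and the user, with CDF $F(\gamma)=\Pr(\Upsilon_t\le\gamma)$. Then, for every real $\gamma$, $F(\gamma)$ is the area of $S(P_t,\gamma)\cap S(C,\theta_c)$ divided by the area $2\pi r_{\mathrm e}^2(1-\cos\theta_c)$ of the cell. Moreover, $F(\gamma)=0$ for $\gamma<\max(0,\theta_v-\theta_c)$, $F(\gamma)=1$ for $\gamma>\theta_c+\theta_v$, and for every $\gamma$ with $\max(0,\theta_v-\theta_c)\le\gamma\le\theta_c+\theta_v$ and $\gamma\le\pi/2$ it is given by the first of the following cases that applies: \[ F(\gamma)=\begin{cases}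 \dfrac{1-\cos\gamma}{1-\cos\theta_c}, & \text{Case 1: } 0\le\gamma\le\theta_c-\theta_v,\\[2mm] \dfrac{1-\cos\gamma}{1-\cos\theta_c}+\dfrac{V_{\theta_v+\theta_{\min},\,\theta_c}-V_{\theta_{\min},\,\gamma}}{2(1-\cos\theta_c)}, & \text{Case 2: } \theta_c>\theta_v \text{ and } \cos\gamma\cos\theta_v\ge\cos\theta_c,\\[2mm] 1+\dfrac{V_{\theta_v+\theta_{\min},\,\gamma}-V_{\theta_{\min},\,\theta_c}}{2(1-\cos\theta_c)}, & \text{Case 3: } \theta_v<\gamma\le\theta_c+\theta_v \text{ and } \cos\gamma\le\cos\theta_c\cos\theta_v,\\[2mm] \dfrac{V_{\theta_{\min},\,\theta_c}+V_{\theta_v-\theta_{\min},\,\gamma}}{2(1-\cos\theta_c)}, & \text{Case 4: otherwise,} \end{cases} \] where \[ \theta_{\min}=\begin{cases} \arctan\!\left(\dfrac1{\tan\theta_v}-\dfrac{\cos\theta_c}{\cos\gamma\,\sin\theta_v}\right) & \text{in Case 2},\\[2mm] \arctan\!\left(\dfrac1{\tan\theta_v}-\dfrac{\cos\gamma}{\cos\theta_c\,\sin\theta_v}\right)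 & \text{in Case 3},\\[2mm] \arctan\!\left(\dfrac{\cos\gamma}{\cos\theta_c\,\sin\theta_v}-\dfrac1{\tan\theta_v}\right) & \text{in Case 4}, \end{cases} \qquad V_{u,v}=\int_u^v \sin\phi\; I_{1-(\tan u/\tan\phi)^2}\!\left(\tfrac12,\tfrac12\right)\,d\phi , \] $1/\tan(\pi/2)$ is read as $0$, and $I_x(a,b)=\int_0^x t^{a-1}(1-t)^{b-1}\,dt\big/\int_0^1 t^{a-1}(1-t)^{b-1}\,dt$ is the regularized incomplete beta function. -/

import Mathlib

open Set MeasureTheory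

noncomputable section

namespace SphericalCell

/-- Euclidean three-space, with the center of the Earth at the origin. -/
abbrev E3 : Type := EuclideanSpace ℝ (Fin 3)

/-- Surface area measure on the sphere of radius `r` centered at the origin, as a measure on `E3`:
the area measure of the unit sphere, transported by `x ↦ r • x` and scaled by `r ^ 2`. -/
def sphereArea (r : ℝ) : Measure E3 :=
  ENNReal.ofReal (r ^ 2) •
    ((volume : Measure E3).toSphere).map
      (fun x : Metric.sphere (0 : E3) 1 => r • (x : E3))

/-- The spherical cap `S(c, θ)` on the sphere of radius `r`: the points of the sphere whose
central angle to `c` is at most `θ`. -/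
def sphericalCap (r : ℝ) (c : E3) (θ : ℝ) : Set E3 :=
  {x | x ∈ Metric.sphere (0 : E3) r ∧ InnerProductGeometry.angle c x ≤ θ}

/-- The radial projection onto the sphere of radius `r` of a point `q ≠ 0` of space. -/
def groundProjection (r : ℝ) (q : E3) : E3 := (r / ‖q‖) • q

/-- The regularized incomplete beta function `I_x(a, b)`, for `0 ≤ x ≤ 1` and `a, b > 0`. -/
def regIncBeta (x a b : ℝ) : ℝ :=
  (∫ t in (0 : ℝ)..x, t ^ (a - 1) * (1 - t) ^ (b - 1)) /
    (∫ t in (0 : ℝ)..1, t ^ (a - 1) * (1 - t) ^ (b - 1))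

/-- The integral `V_{u,v}`. -/
def V (u v : ℝ) : ℝ :=
  ∫ φ in u..v,
    Real.sin φ * regIncBeta (1 - (Real.tan u / Real.tan φ) ^ 2) (1 / 2) (1 / 2)

/-- The angle `θ_min` of Case 2. -/
def thetaMin₂ (γ θc θv : ℝ) : ℝ :=
  Real.arctan (1 / Real.tan θv - Real.cos θc / (Real.cos γ * Real.sin θv))

/-- The angle `θ_min` of Case 3. -/
def thetaMin₃ (γ θc θv : ℝ) : ℝ :=
  Real.arctan (1 / Real.tan θv - Real.cos γ / (Real.cos θc * Real.sin θv))

/-- The angle `θ_min` of Case 4. -/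
def thetaMin₄ (γ θc θv : ℝ) : ℝ :=
  Real.arctan (Real.cos γ / (Real.cos θc * Real.sin θv) - 1 / Real.tan θv)

open Classical in
/-- The piecewise expression `F(γ, θc ∣ θv)`; the cases are tried in the order listed. -/
def centralAngleFormula (γ θc θv : ℝ) : ℝ :=
  if 0 ≤ γ ∧ γ ≤ θc - θv then
    (1 - Real.cos γ) / (1 - Real.cos θc)
  else if θv < θc ∧ Real.cos θc ≤ Real.cos γ * Real.cos θv then
    (1 - Real.cos γ) / (1 - Real.cos θc) +
      1 / (2 * (1 - Real.cos θc)) *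
        (V (θv + thetaMin₂ γ θc θv) θc - V (thetaMin₂ γ θc θv) γ)
  else if (θv < γ ∧ γ ≤ θc + θv) ∧ Real.cos γ ≤ Real.cos θc * Real.cos θv then
    1 + 1 / (2 * (1 - Real.cos θc)) *
        (V (θv + thetaMin₃ γ θc θv) γ - V (thetaMin₃ γ θc θv) θc)
  else
    1 / (2 * (1 - Real.cos θc)) *
        (V (thetaMin₄ γ θc θv) θc + V (θv - thetaMin₄ γ θc θv) γ)

end SphericalCell

end

namespace SphericalCell

open scoped ENNReal RealInnerProductSpace

/-! Uniformity makes the CDF a ratio of areas, so everything rests on the area of the intersection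
of two caps. The link with `V` is `I_{1-a²}(1/2, 1/2) = 2 arccos a / π`: hence `π * V u v` is the
integral over `φ` of `sin φ * 2 arccos (tan u / tan φ)`. In spherical coordinates about the center
of a cap, `2 arccos (tan u / tan φ)` is the length of the longitude range in which the circle of
colatitude `φ` lies beyond a great circle at distance `u` from the center. So `π * V u v` is the
area, on the unit sphere, of the part of a cap of angle `v` beyond that great circle
(`unitSphereArea_wedge`). A great circle passing on the other side of the center gives the
complementary part (`unitSphereArea_real_wedge_signed`).

If the boundaries of two caps of angles `α`, `β` at distance `θ` meet, the great circle through the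
common points (the chord) divides the intersection into a wedge of each cap
(`unitSphereArea_real_lens`). The signed distance `u` of the chord from the first center solves `cos
β cos u = cos α cos (θ - u)`; this is `chordAngle`, and `θ_min` is it up to sign. The cases record
the position of the chord: between the centers (Case 4), behind the cell center (Case 3), behind the
satellite (Case 2). In Case 1 the satellite's cap lies inside the cell. The constant values 0 and 1
follow from the triangle inequality for angles. -/

/-! ### The beta integral and an elementary form of `V` -/

theorem integral_rpow_neg_half_mul {x : ℝ} (h0 : 0 ≤ x) (h1 : x ≤ 1) :
    ∫ t in (0 : ℝ)..x, t ^ ((1 / 2 : ℝ) - 1) * (1 - t) ^ ((1 / 2 : ℝ) - 1) =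
      2 * Real.arcsin √x := by
  have hcont : ContinuousOn (fun t : ℝ => 2 * Real.arcsin √t) (Icc 0 x) := by
    have := Real.continuous_arcsin
    fun_prop
  have hderiv : ∀ t ∈ Ioo (0 : ℝ) x, HasDerivAt (fun t : ℝ => 2 * Real.arcsin √t)
      (t ^ ((1 / 2 : ℝ) - 1) * (1 - t) ^ ((1 / 2 : ℝ) - 1)) t := by
    intro t ht
    have ht0 : 0 < t := ht.1
    have ht1 : 0 < 1 - t := by linarith [ht.2]
    have hs0 : 0 < √t := Real.sqrt_pos.2 ht0
    have hs1 : √t < 1 := by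
      rw [Real.sqrt_lt' one_pos]; linarith
    have h := ((Real.hasDerivAt_arcsin (x := √t) (by linarith) hs1.ne).comp t
      (Real.hasDerivAt_sqrt ht0.ne')).const_mul 2
    refine h.congr_deriv ?_
    have e : ((1 / 2 : ℝ) - 1) = -(1 / 2) := by norm_num
    rw [e, Real.rpow_neg ht0.le, Real.rpow_neg ht1.le, ← Real.sqrt_eq_rpow, ← Real.sqrt_eq_rpow,
      Real.sq_sqrt ht0.le]
    have := Real.sqrt_pos.2 ht1
    field_simp
  -- The integrand is unbounded near 0, and near 1 if `x = 1`; being nonnegative with a continuous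
  -- antiderivative, it is integrable all the same.
  have hint := intervalIntegral.integrableOn_deriv_of_nonneg hcont hderiv (fun t ht =>
    mul_nonneg (Real.rpow_nonneg ht.1.le _) (Real.rpow_nonneg (by linarith [ht.2]) _))
  rw [intervalIntegral.integral_eq_sub_of_hasDerivAt_of_le h0 hcont hderiv
    ((intervalIntegrable_iff_integrableOn_Ioc_of_le h0).2 hint)]
  simp

/-- For `a ≥ 0`, `arcsin √(1 - a²) = arccos a`, and the complete integral is `2 arcsin 1 = π`. -/
theorem regIncBeta_one_sub_sq {a : ℝ} (h0 : 0 ≤ a) (h1 : a ≤ 1) :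
    regIncBeta (1 - a ^ 2) (1 / 2) (1 / 2) = 2 * Real.arccos a / Real.pi := by
  rw [regIncBeta, integral_rpow_neg_half_mul (by nlinarith) (by nlinarith),
    integral_rpow_neg_half_mul zero_le_one le_rfl, Real.arccos_eq_arcsin h0]
  simp only [Real.sqrt_one, Real.arcsin_one]
  congr 1
  ring

theorem tan_div_tan_mem {u φ : ℝ} (hu : 0 ≤ u) (hφ : u ≤ φ) (hφ' : φ < Real.pi / 2) :
    0 ≤ Real.tan u / Real.tan φ ∧ Real.tan u / Real.tan φ ≤ 1 := by
  have h1 : 0 ≤ Real.tan u := Real.tan_nonneg_of_nonneg_of_le_pi_div_two hu (by linarith)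
  have h2 : Real.tan u ≤ Real.tan φ := by
    rcases hφ.eq_or_lt with h | h
    · rw [h]
    · exact (Real.tan_lt_tan_of_nonneg_of_lt_pi_div_two hu hφ' h).le
  exact ⟨div_nonneg h1 (h1.trans h2), div_le_one_of_le₀ h2 (h1.trans h2)⟩

theorem pi_mul_V {u v : ℝ} (hu : 0 ≤ u) (huv : u ≤ v) (hv : v ≤ Real.pi / 2) :
    Real.pi * V u v =
      ∫ φ in u..v, Real.sin φ * (2 * Real.arccos (Real.tan u / Real.tan φ)) := by
  rw [V, ← intervalIntegral.integral_const_mul]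
  apply intervalIntegral.integral_congr_ae
  -- At `π / 2` the default value `tan = 0` breaks the monotonicity of `tan`; one point is null.
  have : ∀ᵐ φ : ℝ, φ ≠ Real.pi / 2 := by simp [ae_iff]
  filter_upwards [this] with φ hne hφ
  rw [uIoc_of_le huv] at hφ
  obtain ⟨h0, h1⟩ := tan_div_tan_mem hu hφ.1.le (lt_of_le_of_ne (hφ.2.trans hv) hne)
  rw [regIncBeta_one_sub_sq h0 h1]
  have := Real.pi_ne_zero
  field_simp

theorem V_zero_left {v : ℝ} (h0 : 0 ≤ v) (hv : v ≤ Real.pi / 2) : V 0 v = 1 - Real.cos v := by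
  have := pi_mul_V le_rfl h0 hv
  simp only [Real.tan_zero, zero_div, Real.arccos_zero, intervalIntegral.integral_mul_const,
    integral_sin, Real.cos_zero] at this
  have hpi := Real.pi_ne_zero
  apply mul_left_cancel₀ hpi
  rw [this]; ring

/-! ### Spherical coordinates -/

theorem lintegral_polar {f : ℝ → ℝ → ℝ≥0∞} (hf : Measurable fun p : ℝ × ℝ => f p.1 p.2) :
    ∫⁻ x, ∫⁻ y, f x y = ∫⁻ l in Ioo (-Real.pi) Real.pi, ∫⁻ R in Ioi (0 : ℝ),
      ENNReal.ofReal R * f (R * Real.cos l) (R * Real.sin l) := by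
  have h := lintegral_comp_polarCoord_symm (fun p : ℝ × ℝ => f p.1 p.2)
  rw [Measure.volume_eq_prod, lintegral_prod _ hf.aemeasurable] at h
  rw [← h, polarCoord_target, ← Measure.prod_restrict, lintegral_prod_symm]
  · simp [polarCoord_symm_apply]
  · simp only [polarCoord_symm_apply, smul_eq_mul]
    refine Measurable.aemeasurable (Measurable.mul (by fun_prop) ?_)
    exact hf.comp (f := fun p : ℝ × ℝ => (p.1 * Real.cos p.2, p.1 * Real.sin p.2)) (by fun_prop)

/-- Two polar changes: `(x, y) = (ρ cos l, ρ sin l)`, then `(z, ρ) = (R cos φ, R sin φ)`. The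
Jacobians multiply to `ρ R = R² sin φ`. -/
theorem lintegral_spherical {f : ℝ → ℝ → ℝ → ℝ≥0∞}
    (hf : Measurable fun p : ℝ × ℝ × ℝ => f p.1 p.2.1 p.2.2) :
    ∫⁻ z, ∫⁻ x, ∫⁻ y, f z x y =
      ∫⁻ l in Ioo (-Real.pi) Real.pi, ∫⁻ φ in Ioo 0 Real.pi, ∫⁻ R in Ioi (0 : ℝ),
        ENNReal.ofReal (R ^ 2 * Real.sin φ) *
          f (R * Real.cos φ) (R * Real.sin φ * Real.cos l) (R * Real.sin φ * Real.sin l) := by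
  calc ∫⁻ z, ∫⁻ x, ∫⁻ y, f z x y
    _ = ∫⁻ z, ∫⁻ l in Ioo (-Real.pi) Real.pi, ∫⁻ ρ in Ioi (0 : ℝ),
          ENNReal.ofReal ρ * f z (ρ * Real.cos l) (ρ * Real.sin l) := by
        congr with z
        exact lintegral_polar (hf.comp (f := fun p : ℝ × ℝ => (z, p.1, p.2)) (by fun_prop))
    _ = ∫⁻ l in Ioo (-Real.pi) Real.pi, ∫⁻ z, ∫⁻ ρ in Ioi (0 : ℝ),
          ENNReal.ofReal ρ * f z (ρ * Real.cos l) (ρ * Real.sin l) := by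
        rw [lintegral_lintegral_swap]
        refine Measurable.aemeasurable (Measurable.lintegral_prod_right' (f := fun p : (ℝ × ℝ) × ℝ =>
          ENNReal.ofReal p.2 * f p.1.1 (p.2 * Real.cos p.1.2) (p.2 * Real.sin p.1.2)) ?_)
        refine Measurable.mul (by fun_prop) ?_
        exact hf.comp (f := fun p : (ℝ × ℝ) × ℝ =>
          (p.1.1, p.2 * Real.cos p.1.2, p.2 * Real.sin p.1.2)) (by fun_prop)
    _ = _ := by
        congr with l
        -- Extension by zero to `ρ ≤ 0` makes the pair `(z, ρ)` range over the whole plane; the half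
        -- `φ ≤ 0` of the second polar change then contributes nothing.
        have key : ∀ z, ∫⁻ ρ in Ioi (0 : ℝ), ENNReal.ofReal ρ *
            f z (ρ * Real.cos l) (ρ * Real.sin l) = ∫⁻ ρ, (Ioi (0 : ℝ)).indicator (fun ρ =>
              ENNReal.ofReal ρ * f z (ρ * Real.cos l) (ρ * Real.sin l)) ρ := fun z =>
          (lintegral_indicator measurableSet_Ioi _).symm
        simp_rw [key]
        rw [lintegral_polar]
        · rw [← Ioc_union_Ioo_eq_Ioo (a := -Real.pi) (b := 0) (c := Real.pi) (by linarith [Real.pi_pos])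
            Real.pi_pos, lintegral_union measurableSet_Ioo
            (Set.disjoint_left.2 fun x hx hx' => absurd hx.2 (not_le.2 hx'.1))]
          have h0 : ∫⁻ φ in Ioc (-Real.pi) 0, ∫⁻ R in Ioi (0 : ℝ), ENNReal.ofReal R *
              (Ioi (0 : ℝ)).indicator (fun ρ => ENNReal.ofReal ρ *
                f (R * Real.cos φ) (ρ * Real.cos l) (ρ * Real.sin l)) (R * Real.sin φ) = 0 := by
            rw [setLIntegral_congr_fun (g := fun _ => 0) measurableSet_Ioc]
            · simp
            intro φ hφ
            dsimp only
            rw [setLIntegral_congr_fun (g := fun _ => 0) measurableSet_Ioi]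
            · simp
            intro R hR
            have : R * Real.sin φ ≤ 0 := mul_nonpos_of_nonneg_of_nonpos (le_of_lt hR)
              (Real.sin_nonpos_of_nonpos_of_neg_pi_le hφ.2 hφ.1.le)
            simp [indicator, this]
          rw [h0, zero_add]
          refine setLIntegral_congr_fun measurableSet_Ioo fun φ hφ => ?_
          refine setLIntegral_congr_fun measurableSet_Ioi fun R hR => ?_
          have hs : 0 < R * Real.sin φ := mul_pos hR (Real.sin_pos_of_mem_Ioo hφ)
          rw [indicator_of_mem (show _ ∈ Ioi _ from hs), ← mul_assoc,
            ← ENNReal.ofReal_mul (le_of_lt hR)]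
          congr 2
          ring
        · have : (fun p : ℝ × ℝ => (Ioi (0 : ℝ)).indicator (fun ρ => ENNReal.ofReal ρ *
              f p.1 (ρ * Real.cos l) (ρ * Real.sin l)) p.2) =
              (univ ×ˢ Ioi (0 : ℝ)).indicator (fun p : ℝ × ℝ => ENNReal.ofReal p.2 *
              f p.1 (p.2 * Real.cos l) (p.2 * Real.sin l)) := by
            ext p; simp [indicator]
          rw [this]
          refine Measurable.indicator ?_ (by measurability)
          refine Measurable.mul (by fun_prop) ?_
          exact hf.comp (f := fun p : ℝ × ℝ =>
            (p.1, p.2 * Real.cos l, p.2 * Real.sin l)) (by fun_prop)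

/-- The volume in spherical coordinates of the part of a cone in the unit ball. -/
theorem volume_cone_inter_ball {S : Set (ℝ × ℝ × ℝ)} (hS : MeasurableSet S)
    (hcone : ∀ t > 0, ∀ z x y : ℝ, (t * z, t * x, t * y) ∈ S ↔ (z, x, y) ∈ S) :
    3 * volume {p : ℝ × ℝ × ℝ | p.1 ^ 2 + p.2.1 ^ 2 + p.2.2 ^ 2 < 1 ∧ p ∈ S} =
      ∫⁻ φ in Ioo 0 Real.pi, ENNReal.ofReal (Real.sin φ) *
        volume {l ∈ Ioo (-Real.pi) Real.pi |
          (Real.cos φ, Real.sin φ * Real.cos l, Real.sin φ * Real.sin l) ∈ S} := by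
  set B : Set (ℝ × ℝ × ℝ) := {p | p.1 ^ 2 + p.2.1 ^ 2 + p.2.2 ^ 2 < 1 ∧ p ∈ S} with hB
  have hBm : MeasurableSet B :=
    (measurableSet_lt (f := fun p : ℝ × ℝ × ℝ => p.1 ^ 2 + p.2.1 ^ 2 + p.2.2 ^ 2)
      (g := fun _ => 1) (by fun_prop) (by fun_prop)).inter hS
  have hm : Measurable (B.indicator (fun _ => (1 : ℝ≥0∞))) := measurable_const.indicator hBm
  have hSm : Measurable (S.indicator (fun _ => (1 : ℝ≥0∞))) := measurable_const.indicator hS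
  -- The radial integral separates because `S` is invariant under scaling; its value `1 / 3` cancels
  -- the factor 3.
  have hrad : ∫⁻ R in Ioo (0 : ℝ) 1, ENNReal.ofReal (R ^ 2) = 3⁻¹ := by
    rw [Measure.restrict_congr_set Ioo_ae_eq_Ioc,
      ← ofReal_integral_eq_lintegral_ofReal (intervalIntegral.intervalIntegrable_pow 2).1
        (ae_of_all _ fun R => sq_nonneg R), ← intervalIntegral.integral_of_le zero_le_one]
    rw [integral_pow, show ((1 : ℝ) ^ (2 + 1) - 0 ^ (2 + 1)) / ((2 : ℕ) + 1) = 3⁻¹ by norm_num,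
      ENNReal.ofReal_inv_of_pos (by norm_num)]
    norm_num
  have hvol : volume B = ∫⁻ z, ∫⁻ x, ∫⁻ y, B.indicator (fun _ => (1 : ℝ≥0∞)) (z, x, y) := by
    rw [← lintegral_indicator_one hBm, Measure.volume_eq_prod]
    refine (lintegral_prod _ hm.aemeasurable).trans ?_
    congr with z
    rw [Measure.volume_eq_prod, lintegral_prod]
    · exact (hm.comp (f := fun p : ℝ × ℝ => (z, p.1, p.2)) (by fun_prop)).aemeasurable
  rw [hvol, lintegral_spherical (f := fun z x y => B.indicator (fun _ => (1 : ℝ≥0∞)) (z, x, y)) hm]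
  have hinner : ∀ l φ : ℝ, ∫⁻ R in Ioi (0 : ℝ), ENNReal.ofReal (R ^ 2 * Real.sin φ) *
      B.indicator (fun _ => (1 : ℝ≥0∞)) (R * Real.cos φ, R * Real.sin φ * Real.cos l,
        R * Real.sin φ * Real.sin l) = 3⁻¹ * (ENNReal.ofReal (Real.sin φ) *
      S.indicator (fun _ => (1 : ℝ≥0∞))
        (Real.cos φ, Real.sin φ * Real.cos l, Real.sin φ * Real.sin l)) := by
    intro l φ
    rw [← hrad, ← lintegral_mul_const _ (by fun_prop), ← Ioo_union_Ici_eq_Ioi (zero_lt_one' ℝ),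
      lintegral_union measurableSet_Ici
        (Set.disjoint_left.2 fun x hx hx' => absurd hx.2 (not_lt.2 hx'))]
    have hmem : ∀ R > 0, (R * Real.cos φ, R * Real.sin φ * Real.cos l,
        R * Real.sin φ * Real.sin l) ∈ B ↔ R < 1 ∧ (Real.cos φ, Real.sin φ * Real.cos l,
          Real.sin φ * Real.sin l) ∈ S := by
      intro R hR
      rw [hB, mem_ofPred_eq, ← hcone R hR (Real.cos φ)]
      refine and_congr ?_ (by simp only [mul_assoc])
      have : (R * Real.cos φ) ^ 2 + (R * Real.sin φ * Real.cos l) ^ 2 +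
          (R * Real.sin φ * Real.sin l) ^ 2 = R ^ 2 := by
        linear_combination R ^ 2 * Real.sin φ ^ 2 * Real.sin_sq_add_cos_sq l +
          R ^ 2 * Real.sin_sq_add_cos_sq φ
      dsimp only
      rw [this, sq_lt_one_iff₀ hR.le]
    rw [setLIntegral_congr_fun (g := fun _ => 0) measurableSet_Ici, lintegral_zero, add_zero]
    · refine setLIntegral_congr_fun measurableSet_Ioo fun R hR => ?_
      rw [ENNReal.ofReal_mul (sq_nonneg R), mul_assoc]
      congr 2
      by_cases h : (Real.cos φ, Real.sin φ * Real.cos l, Real.sin φ * Real.sin l) ∈ S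
      · rw [indicator_of_mem h, indicator_of_mem ((hmem R hR.1).2 ⟨hR.2, h⟩)]
      · rw [indicator_of_notMem h, indicator_of_notMem fun h' => h ((hmem R hR.1).1 h').2]
    · intro R hR
      have h1 : ¬ R < 1 := not_lt.2 hR
      simp [indicator, hmem R (lt_of_lt_of_le one_pos hR), h1]
  have hjoint : Measurable fun p : ℝ × ℝ => ENNReal.ofReal (Real.sin p.2) *
      S.indicator (fun _ => (1 : ℝ≥0∞))
        (Real.cos p.2, Real.sin p.2 * Real.cos p.1, Real.sin p.2 * Real.sin p.1) :=
    Measurable.mul (by fun_prop) (hSm.comp (f := fun p : ℝ × ℝ => (Real.cos p.2,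
      Real.sin p.2 * Real.cos p.1, Real.sin p.2 * Real.sin p.1)) (by fun_prop))
  simp_rw [hinner]
  rw [lintegral_lintegral_swap (hjoint.const_mul _).aemeasurable,
    ← lintegral_const_mul' _ _ (by norm_num)]
  refine lintegral_congr fun φ => ?_
  have hφ : Measurable fun l : ℝ => S.indicator (fun _ => (1 : ℝ≥0∞))
      (Real.cos φ, Real.sin φ * Real.cos l, Real.sin φ * Real.sin l) :=
    hSm.comp (f := fun l : ℝ => (Real.cos φ, Real.sin φ * Real.cos l, Real.sin φ * Real.sin l))
      (by fun_prop)
  rw [lintegral_const_mul _ (hφ.const_mul _), lintegral_const_mul _ hφ, ← mul_assoc,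
    ENNReal.mul_inv_cancel (by norm_num) (by norm_num), one_mul]
  congr 1
  have hSl : MeasurableSet {l : ℝ | (Real.cos φ, Real.sin φ * Real.cos l,
      Real.sin φ * Real.sin l) ∈ S} :=
    hS.preimage (f := fun l : ℝ => (Real.cos φ, Real.sin φ * Real.cos l,
      Real.sin φ * Real.sin l)) (by fun_prop)
  have : (fun l : ℝ => S.indicator (fun _ => (1 : ℝ≥0∞))
      (Real.cos φ, Real.sin φ * Real.cos l, Real.sin φ * Real.sin l)) =
      {l : ℝ | (Real.cos φ, Real.sin φ * Real.cos l,
      Real.sin φ * Real.sin l) ∈ S}.indicator 1 := by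
    ext l; simp [indicator]
  rw [this, lintegral_indicator_one hSl, Measure.restrict_apply hSl, inter_comm]
  rfl

/-! ### The area of a cap cut by a great circle -/

/-- For `u < φ < π / 2` the half-space condition reads `tan u / tan φ ≤ cos l`, a symmetric interval
of longitudes; for `φ < u` no longitude satisfies it. -/
theorem volume_longitude {u v φ : ℝ} (hu : 0 ≤ u) (hv : v ≤ Real.pi / 2)
    (hφ : φ ∈ Ioo 0 Real.pi) (hne : φ ≠ u) (hne' : φ ≠ Real.pi / 2) (huv : u ≤ v) :
    volume {l ∈ Ioo (-Real.pi) Real.pi | Real.cos v ≤ Real.cos φ ∧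
      Real.sin u * Real.cos φ ≤ Real.cos u * (Real.sin φ * Real.cos l)} =
    (Ioc u v).indicator (fun φ => ENNReal.ofReal (2 * Real.arccos (Real.tan u / Real.tan φ))) φ := by
  have hpi := Real.pi_pos
  have hsin : 0 < Real.sin φ := Real.sin_pos_of_mem_Ioo hφ
  rcases lt_or_ge v φ with h | h
  · have hlt : Real.cos φ < Real.cos v :=
      Real.cos_lt_cos_of_nonneg_of_le_pi (hu.trans huv) hφ.2.le h
    rw [indicator_of_notMem (by simp [h])]
    convert measure_empty (μ := (volume : Measure ℝ))
    ext l
    simp [hlt]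
  rcases lt_or_gt_of_ne hne with h' | h'
  · rw [indicator_of_notMem (by simp [h'.le])]
    convert measure_empty (μ := (volume : Measure ℝ))
    ext l
    have h1 : 0 < Real.sin (u - φ) := Real.sin_pos_of_pos_of_lt_pi (by linarith) (by linarith [hφ.1])
    rw [Real.sin_sub] at h1
    have h2 : 0 ≤ Real.cos u := Real.cos_nonneg_of_neg_pi_div_two_le_of_le (by linarith) (by linarith)
    have h3 : Real.cos u * (Real.sin φ * Real.cos l) ≤ Real.cos u * Real.sin φ :=
      mul_le_mul_of_nonneg_left (mul_le_of_le_one_right hsin.le (Real.cos_le_one l)) h2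
    have h4 : ¬ Real.sin u * Real.cos φ ≤ Real.cos u * (Real.sin φ * Real.cos l) := by linarith
    simp [h4]
  · have hφ2 : φ < Real.pi / 2 := lt_of_le_of_ne (h.trans hv) hne'
    obtain ⟨h0, h1⟩ := tan_div_tan_mem hu h'.le hφ2
    rw [indicator_of_mem (show φ ∈ Ioc u v from ⟨h', h⟩)]
    have hcu : 0 < Real.cos u := Real.cos_pos_of_mem_Ioo ⟨by linarith, by linarith⟩
    have hcφ : 0 < Real.cos φ := Real.cos_pos_of_mem_Ioo ⟨by linarith, by linarith⟩
    have hle : Real.cos v ≤ Real.cos φ :=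
      Real.cos_le_cos_of_nonneg_of_le_pi hφ.1.le (by linarith) h
    have hacos : Real.arccos (Real.tan u / Real.tan φ) ≤ Real.pi / 2 := Real.arccos_le_pi_div_two.2 h0
    have hset : {l ∈ Ioo (-Real.pi) Real.pi | Real.cos v ≤ Real.cos φ ∧
        Real.sin u * Real.cos φ ≤ Real.cos u * (Real.sin φ * Real.cos l)} =
        Icc (-Real.arccos (Real.tan u / Real.tan φ)) (Real.arccos (Real.tan u / Real.tan φ)) := by
      have hiff : ∀ l, Real.sin u * Real.cos φ ≤ Real.cos u * (Real.sin φ * Real.cos l) ↔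
          Real.tan u / Real.tan φ ≤ Real.cos l := by
        intro l
        rw [Real.tan_eq_sin_div_cos, Real.tan_eq_sin_div_cos, div_div_div_eq,
          div_le_iff₀ (by positivity)]
        constructor <;> intro h <;> linarith
      ext l
      simp only [mem_ofPred_eq, mem_Ioo, hle, true_and, hiff, mem_Icc, ← abs_lt, ← abs_le]
      rw [← Real.cos_abs l]
      constructor
      · rintro ⟨hl, hc⟩
        have := Real.arccos_le_arccos hc
        rwa [Real.arccos_cos (abs_nonneg l) hl.le] at this
      · intro hl
        refine ⟨by linarith, ?_⟩
        have := Real.cos_le_cos_of_nonneg_of_le_pi (abs_nonneg l) (by linarith) hl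
        rwa [Real.cos_arccos (by linarith) h1] at this
    rw [hset, Real.volume_Icc]
    congr 1
    ring

/-- The area measure of the unit sphere, as a measure on `E3`. -/
noncomputable def unitSphereArea : Measure E3 :=
  ((volume : Measure E3).toSphere).map Subtype.val

instance : IsFiniteMeasure unitSphereArea := by
  unfold unitSphereArea; infer_instance

/-- `toSphere` assigns to a set 3 times the volume of the cone over it in the unit ball. For a
scale-invariant set that cone is the set itself in the open ball, up to the origin. -/
theorem unitSphereArea_cone {A : Set E3} (hA : MeasurableSet A)
    (hcone : ∀ t > (0 : ℝ), ∀ x, t • x ∈ A ↔ x ∈ A) :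
    unitSphereArea A = 3 * volume {x : E3 | ‖x‖ < 1 ∧ x ∈ A} := by
  rw [unitSphereArea, Measure.map_apply measurable_subtype_coe hA,
    Measure.toSphere_apply' _ (measurable_subtype_coe hA), finrank_euclideanSpace_fin]
  congr 1
  refine measure_congr (Filter.eventuallyEq_set.2 ?_)
  have h0 : ∀ᵐ x : E3, x ≠ 0 := by simp [ae_iff]
  filter_upwards [h0] with x hx
  simp only [mem_smul, mem_image, mem_preimage]
  constructor
  · rintro ⟨t, ht, _, ⟨y, hy, rfl⟩, rfl⟩
    have : ‖(y : E3)‖ = 1 := by simp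
    rw [hcone t ht.1, norm_smul, this, mul_one, Real.norm_of_nonneg ht.1.le]
    exact ⟨ht.2, hy⟩
  · rintro ⟨h1, h2⟩
    have hpos : 0 < ‖x‖ := norm_pos_iff.2 hx
    refine ⟨‖x‖, ⟨hpos, h1⟩, ‖x‖⁻¹ • x, ⟨⟨‖x‖⁻¹ • x, ?_⟩, ?_, rfl⟩, ?_⟩
    · simp [norm_smul, hpos.ne']
    · exact (hcone _ (inv_pos.2 hpos) x).2 h2
    · rw [smul_smul, mul_inv_cancel₀ hpos.ne', one_smul]

theorem measurePreserving_frame (b : OrthonormalBasis (Fin 3) ℝ E3) :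
    MeasurePreserving (fun x : E3 => ((⟪b 0, x⟫, ⟪b 1, x⟫, ⟪b 2, x⟫) : ℝ × ℝ × ℝ)) := by
  have h1 := (PiLp.volume_preserving_ofLp (Fin 3)).comp b.measurePreserving_repr
  have h2 := (volume_preserving_piFinSuccAbove (fun _ : Fin 3 => ℝ) 0).comp h1
  have h3 := ((MeasurePreserving.id (volume : Measure ℝ)).prod
    (volume_preserving_finTwoArrow ℝ)).comp h2
  have e : (fun x : E3 => ((⟪b 0, x⟫, ⟪b 1, x⟫, ⟪b 2, x⟫) : ℝ × ℝ × ℝ)) =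
      Prod.map id MeasurableEquiv.finTwoArrow ∘
        MeasurableEquiv.piFinSuccAbove (fun _ => ℝ) 0 ∘ WithLp.ofLp ∘ b.repr := by
    funext x
    simp only [← OrthonormalBasis.repr_apply_apply]
    rfl
  rw [e]
  exact h3

theorem unitSphereArea_eq_lintegral (b : OrthonormalBasis (Fin 3) ℝ E3) {S : Set (ℝ × ℝ × ℝ)}
    (hS : MeasurableSet S)
    (hcone : ∀ t > 0, ∀ z x y : ℝ, (t * z, t * x, t * y) ∈ S ↔ (z, x, y) ∈ S) :
    unitSphereArea {x | (⟪b 0, x⟫, ⟪b 1, x⟫, ⟪b 2, x⟫) ∈ S} =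
      ∫⁻ φ in Ioo 0 Real.pi, ENNReal.ofReal (Real.sin φ) *
        volume {l ∈ Ioo (-Real.pi) Real.pi |
          (Real.cos φ, Real.sin φ * Real.cos l, Real.sin φ * Real.sin l) ∈ S} := by
  have hf := measurePreserving_frame b
  have hB : MeasurableSet {p : ℝ × ℝ × ℝ | p.1 ^ 2 + p.2.1 ^ 2 + p.2.2 ^ 2 < 1 ∧ p ∈ S} :=
    (measurableSet_lt (f := fun p : ℝ × ℝ × ℝ => p.1 ^ 2 + p.2.1 ^ 2 + p.2.2 ^ 2)
      (g := fun _ => 1) (by fun_prop) (by fun_prop)).inter hS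
  rw [← volume_cone_inter_ball hS hcone, show {x : E3 | (⟪b 0, x⟫, ⟪b 1, x⟫, ⟪b 2, x⟫) ∈ S} =
      (fun x : E3 => (⟪b 0, x⟫, ⟪b 1, x⟫, ⟪b 2, x⟫)) ⁻¹' S from rfl,
    unitSphereArea_cone (hf.measurable hS),
    ← hf.measure_preimage hB.nullMeasurableSet]
  · congr 2
    ext x
    have := b.sum_sq_norm_inner_right x
    simp only [Fin.sum_univ_three, Real.norm_eq_abs, sq_abs] at this
    simp only [mem_ofPred_eq, mem_preimage, this, sq_lt_one_iff₀ (norm_nonneg x)]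
  · intro t ht x
    simp only [mem_preimage, inner_smul_right, hcone t ht]

theorem exists_frame {c n : E3} (hc : ‖c‖ = 1) (hn : ‖n‖ = 1) (hcn : ⟪c, n⟫ = 0) :
    ∃ b : OrthonormalBasis (Fin 3) ℝ E3, b 0 = c ∧ b 1 = n := by
  have hv : Orthonormal ℝ (({0, 1} : Set (Fin 3)).domRestrict ![c, n, 0]) := by
    rw [orthonormal_iff_ite]
    have hnc : ⟪n, c⟫ = 0 := by rw [real_inner_comm, hcn]
    rintro ⟨i, hi⟩ ⟨j, hj⟩
    simp only [mem_insert_iff, mem_singleton_iff] at hi hj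
    rcases hi with rfl | rfl <;> rcases hj with rfl | rfl <;> simp [hc, hn, hcn, hnc]
  obtain ⟨b, hb⟩ := hv.exists_orthonormalBasis_extension_of_card_eq (by simp)
  exact ⟨b, by simpa using hb 0 (by simp), by simpa using hb 1 (by simp)⟩

/-- The solid cone of half-angle `v` about `c`. -/
def cone (c : E3) (v : ℝ) : Set E3 := {x | Real.cos v * ‖x‖ ≤ ⟪c, x⟫}

/-- The half-space `⟪w, ·⟫ ≥ 0`. -/
def halfSpace (w : E3) : Set E3 := {x | 0 ≤ ⟪w, x⟫}

theorem measurableSet_halfSpace (w : E3) : MeasurableSet (halfSpace w) :=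
  measurableSet_le (by fun_prop) (by fun_prop)

/-- The boundary great circle is orthogonal to `cos u • n - sin u • c`, so it meets the arc from `c`
towards `n` at `cos u • c + sin u • n`, at distance `u` from `c`. With `c` as pole and `n` at
longitude 0, the cap is `φ ≤ v` and each circle of colatitude is measured by `volume_longitude`. -/
theorem unitSphereArea_wedge {c n : E3} (hc : ‖c‖ = 1) (hn : ‖n‖ = 1) (hcn : ⟪c, n⟫ = 0)
    {u v : ℝ} (hu : 0 ≤ u) (huv : u ≤ v) (hv : v ≤ Real.pi / 2) :
    unitSphereArea (cone c v ∩ halfSpace (Real.cos u • n - Real.sin u • c)) =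
      ENNReal.ofReal (Real.pi * V u v) := by
  obtain ⟨b, rfl, rfl⟩ := exists_frame hc hn hcn
  have hpi := Real.pi_pos
  set S : Set (ℝ × ℝ × ℝ) := {p | Real.cos v * √(p.1 ^ 2 + p.2.1 ^ 2 + p.2.2 ^ 2) ≤ p.1 ∧
    Real.sin u * p.1 ≤ Real.cos u * p.2.1} with hSdef
  have hS : MeasurableSet S := by
    refine MeasurableSet.inter (s₁ := {p : ℝ × ℝ × ℝ |
      Real.cos v * √(p.1 ^ 2 + p.2.1 ^ 2 + p.2.2 ^ 2) ≤ p.1})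
      (s₂ := {p | Real.sin u * p.1 ≤ Real.cos u * p.2.1}) ?_ ?_
    · exact measurableSet_le (by fun_prop) (by fun_prop)
    · exact measurableSet_le (by fun_prop) (by fun_prop)
  have hcone : ∀ t > 0, ∀ z x y : ℝ, (t * z, t * x, t * y) ∈ S ↔ (z, x, y) ∈ S := by
    intro t ht z x y
    simp only [hSdef, mem_ofPred_eq]
    rw [show (t * z) ^ 2 + (t * x) ^ 2 + (t * y) ^ 2 = t ^ 2 * (z ^ 2 + x ^ 2 + y ^ 2) by ring,
      Real.sqrt_mul (sq_nonneg t), Real.sqrt_sq ht.le, mul_left_comm, mul_left_comm _ t,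
      mul_left_comm _ t, mul_le_mul_iff_right₀ ht, mul_le_mul_iff_right₀ ht]
  have hset : cone (b 0) v ∩ halfSpace (Real.cos u • b 1 - Real.sin u • b 0) =
      {x | (⟪b 0, x⟫, ⟪b 1, x⟫, ⟪b 2, x⟫) ∈ S} := by
    ext x
    have := b.sum_sq_norm_inner_right x
    simp only [Fin.sum_univ_three, Real.norm_eq_abs, sq_abs] at this
    simp only [cone, halfSpace, hSdef, mem_inter_iff, mem_ofPred_eq, this,
      Real.sqrt_sq (norm_nonneg x), inner_sub_left, inner_smul_left, RCLike.conj_to_real, sub_nonneg]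
  rw [hset, unitSphereArea_eq_lintegral b hS hcone, pi_mul_V hu huv hv,
    intervalIntegral.integral_of_le huv, ofReal_integral_eq_lintegral_ofReal]
  · rw [← lintegral_indicator measurableSet_Ioo, ← lintegral_indicator measurableSet_Ioc]
    have e1 : ∀ᵐ φ : ℝ, φ ≠ u := by simp [ae_iff]
    have e2 : ∀ᵐ φ : ℝ, φ ≠ Real.pi / 2 := by simp [ae_iff]
    refine lintegral_congr_ae ?_
    filter_upwards [e1, e2] with φ h1 h2
    by_cases hφ : φ ∈ Ioo 0 Real.pi
    · rw [indicator_of_mem hφ]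
      have hl := volume_longitude hu hv hφ h1 h2 huv
      have hsin : 0 < Real.sin φ := Real.sin_pos_of_mem_Ioo hφ
      have hset' : {l ∈ Ioo (-Real.pi) Real.pi |
          (Real.cos φ, Real.sin φ * Real.cos l, Real.sin φ * Real.sin l) ∈ S} =
          {l ∈ Ioo (-Real.pi) Real.pi | Real.cos v ≤ Real.cos φ ∧
            Real.sin u * Real.cos φ ≤ Real.cos u * (Real.sin φ * Real.cos l)} := by
        ext l
        have : Real.cos φ ^ 2 + (Real.sin φ * Real.cos l) ^ 2 +
            (Real.sin φ * Real.sin l) ^ 2 = 1 := by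
          linear_combination Real.sin φ ^ 2 * Real.sin_sq_add_cos_sq l + Real.sin_sq_add_cos_sq φ
        simp only [hSdef, mem_ofPred_eq, this, Real.sqrt_one, mul_one]
      rw [hset', hl]
      by_cases hm : φ ∈ Ioc u v
      · rw [indicator_of_mem hm, indicator_of_mem hm, ENNReal.ofReal_mul hsin.le]
      · rw [indicator_of_notMem hm, indicator_of_notMem hm, mul_zero]
    · rw [indicator_of_notMem hφ, indicator_of_notMem]
      intro hm
      exact hφ ⟨hu.trans_lt hm.1, by linarith [hm.2]⟩
  · have hm : Measurable fun φ : ℝ =>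
        Real.sin φ * (2 * Real.arccos (Real.tan u / Real.tan φ)) := by
      have := Real.continuous_arccos.measurable
      simp only [Real.tan_eq_sin_div_cos]
      fun_prop
    refine Measure.integrableOn_of_bounded (M := 2 * Real.pi) (by simp) hm.aestronglyMeasurable
      (ae_of_all _ fun φ => ?_)
    have h0 := Real.arccos_nonneg (Real.tan u / Real.tan φ)
    rw [norm_mul, Real.norm_eq_abs, Real.norm_of_nonneg (by positivity)]
    have h1 := Real.abs_sin_le_one φ
    have h2 := Real.arccos_le_pi (Real.tan u / Real.tan φ)
    nlinarith [abs_nonneg (Real.sin φ)]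
  · filter_upwards [ae_restrict_mem measurableSet_Ioc] with φ hφ
    exact mul_nonneg (Real.sin_nonneg_of_nonneg_of_le_pi (by linarith [hφ.1]) (by linarith [hφ.2]))
      (mul_nonneg two_pos.le (Real.arccos_nonneg _))

theorem V_nonneg {u v : ℝ} (hu : 0 ≤ u) (huv : u ≤ v) (hv : v ≤ Real.pi / 2) : 0 ≤ V u v := by
  have hpi := Real.pi_pos
  refine nonneg_of_mul_nonneg_right (b := V u v) ?_ hpi
  rw [pi_mul_V hu huv hv]
  refine intervalIntegral.integral_nonneg huv fun φ hφ => ?_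
  exact mul_nonneg (Real.sin_nonneg_of_nonneg_of_le_pi (by linarith [hφ.1]) (by linarith [hφ.2]))
    (mul_nonneg two_pos.le (Real.arccos_nonneg _))

theorem unitSphereArea_greatCircle {w : E3} (hw : w ≠ 0) :
    unitSphereArea {x | ⟪w, x⟫ = 0} = 0 := by
  rw [unitSphereArea_cone (measurableSet_eq_fun (by fun_prop) (by fun_prop))]
  · have hsub : {x : E3 | ‖x‖ < 1 ∧ x ∈ {x : E3 | ⟪w, x⟫ = 0}} ⊆
        ((innerₛₗ ℝ w).ker : Submodule ℝ E3) := fun x hx => by simpa using hx.2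
    have htop : (innerₛₗ ℝ w).ker ≠ ⊤ := by
      intro h
      have : w ∈ (innerₛₗ ℝ w).ker := h ▸ Submodule.mem_top
      simp [hw] at this
    rw [measure_mono_null hsub (Measure.addHaar_submodule _ _ htop), mul_zero]
  · intro t ht x
    simp [inner_smul_right, ht.ne']

theorem unitSphereArea_split (A : Set E3) {w : E3} (hw : w ≠ 0) :
    unitSphereArea.real A =
      unitSphereArea.real (A ∩ halfSpace w) + unitSphereArea.real (A ∩ halfSpace (-w)) := by
  rw [← measureReal_inter_add_sdiff (s := A) (t := halfSpace w) (measurableSet_halfSpace w)]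
  congr 1
  refine measureReal_congr (Filter.eventuallyEq_set.2 ?_)
  have : ∀ᵐ x ∂unitSphereArea, ⟪w, x⟫ ≠ 0 := by
    rw [ae_iff]
    simpa using unitSphereArea_greatCircle hw
  filter_upwards [this] with x hx
  simp only [halfSpace, mem_sdiff, mem_inter_iff, mem_ofPred_eq, inner_neg_left, not_le,
    Left.nonneg_neg_iff]
  exact and_congr_right fun _ => ⟨le_of_lt, fun h => lt_of_le_of_ne h hx⟩

theorem norm_sq_combination {c n : E3} (hc : ‖c‖ = 1) (hn : ‖n‖ = 1) (hcn : ⟪c, n⟫ = 0) (a b : ℝ) :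
    ‖a • c + b • n‖ ^ 2 = a ^ 2 + b ^ 2 := by
  rw [norm_add_sq_real, norm_smul, norm_smul, hc, hn, inner_smul_left, inner_smul_right, hcn]
  simp

theorem norm_combination_eq_one {c n : E3} (hc : ‖c‖ = 1) (hn : ‖n‖ = 1) (hcn : ⟪c, n⟫ = 0)
    {a b : ℝ} (hab : a ^ 2 + b ^ 2 = 1) : ‖a • c + b • n‖ = 1 := by
  have := norm_sq_combination hc hn hcn a b
  rw [hab] at this
  exact (pow_eq_one_iff_of_nonneg (norm_nonneg _) two_ne_zero).1 this

theorem wedgeNormal_ne_zero {c n : E3} (hc : ‖c‖ = 1) (hn : ‖n‖ = 1) (hcn : ⟪c, n⟫ = 0) (u : ℝ) :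
    Real.cos u • n - Real.sin u • c ≠ 0 := by
  have h := norm_combination_eq_one hc hn hcn (a := -Real.sin u) (b := Real.cos u)
    (by rw [neg_sq, Real.sin_sq_add_cos_sq])
  have e : Real.cos u • n - Real.sin u • c = (-Real.sin u) • c + Real.cos u • n := by module
  rw [e, ← norm_ne_zero_iff, h]
  exact one_ne_zero

theorem unitSphereArea_real_wedge {c n : E3} (hc : ‖c‖ = 1) (hn : ‖n‖ = 1) (hcn : ⟪c, n⟫ = 0)
    {u v : ℝ} (hu : 0 ≤ u) (huv : u ≤ v) (hv : v ≤ Real.pi / 2) :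
    unitSphereArea.real (cone c v ∩ halfSpace (Real.cos u • n - Real.sin u • c)) =
      Real.pi * V u v := by
  rw [measureReal_def, unitSphereArea_wedge hc hn hcn hu huv hv,
    ENNReal.toReal_ofReal (mul_nonneg Real.pi_pos.le (V_nonneg hu huv hv))]

theorem exists_unit_orthogonal {c : E3} (hc : ‖c‖ = 1) : ∃ n : E3, ‖n‖ = 1 ∧ ⟪c, n⟫ = 0 := by
  have hv : Orthonormal ℝ (({0} : Set (Fin 3)).domRestrict ![c, 0, 0]) := by
    rw [orthonormal_iff_ite]
    rintro ⟨i, hi⟩ ⟨j, hj⟩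
    simp only [mem_singleton_iff] at hi hj
    subst hi hj
    simp [hc]
  obtain ⟨b, hb⟩ := hv.exists_orthonormalBasis_extension_of_card_eq (by simp)
  have h0 : b 0 = c := by simpa using hb 0 (by simp)
  exact ⟨b 1, by simp, by rw [← h0]; exact b.inner_eq_zero (by decide)⟩

/-- A great circle through the center halves the cap into two wedges with `u = 0`. -/
theorem unitSphereArea_real_cone {c : E3} (hc : ‖c‖ = 1) {v : ℝ} (h0 : 0 ≤ v)
    (hv : v ≤ Real.pi / 2) :
    unitSphereArea.real (cone c v) = 2 * Real.pi * (1 - Real.cos v) := by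
  obtain ⟨n, hn, hcn⟩ := exists_unit_orthogonal hc
  have h1 := unitSphereArea_real_wedge hc hn hcn le_rfl h0 hv
  have h2 := unitSphereArea_real_wedge hc (n := -n) (by rwa [norm_neg])
    (by rw [inner_neg_right, hcn, neg_zero]) le_rfl h0 hv
  rw [V_zero_left h0 hv] at h1 h2
  simp only [Real.cos_zero, Real.sin_zero, one_smul, zero_smul, sub_zero] at h1 h2
  rw [unitSphereArea_split (cone c v) (w := n) (by rw [← norm_ne_zero_iff]; simp [hn]),
    h1, h2]
  ring

/-- The area of the part of a cap of angle `v` on the unit sphere that lies beyond the great circle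
at signed distance `u` from the center of the cap. -/
noncomputable def wedgeArea (u v : ℝ) : ℝ :=
  if 0 ≤ u then Real.pi * V u v else 2 * Real.pi * (1 - Real.cos v) - Real.pi * V (-u) v

theorem wedgeArea_of_nonneg {u : ℝ} (hu : 0 ≤ u) (v : ℝ) : wedgeArea u v = Real.pi * V u v :=
  if_pos hu

theorem wedgeArea_of_nonpos {u v : ℝ} (hu : u ≤ 0) (h0 : 0 ≤ v) (hv : v ≤ Real.pi / 2) :
    wedgeArea u v = 2 * Real.pi * (1 - Real.cos v) - Real.pi * V (-u) v := by
  rcases hu.eq_or_lt with rfl | h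
  · rw [wedgeArea_of_nonneg le_rfl, neg_zero, V_zero_left h0 hv]; ring
  · exact if_neg (not_le.2 h)

/-- For `u ≤ 0` the complementary part of the cap is a wedge at distance `-u` in the direction `-n`.
-/
theorem unitSphereArea_real_wedge_signed {c n : E3} (hc : ‖c‖ = 1) (hn : ‖n‖ = 1)
    (hcn : ⟪c, n⟫ = 0) {u v : ℝ} (huv : |u| ≤ v) (hv : v ≤ Real.pi / 2) :
    unitSphereArea.real (cone c v ∩ halfSpace (Real.cos u • n - Real.sin u • c)) =
      wedgeArea u v := by
  have h0 : 0 ≤ v := (abs_nonneg u).trans huv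
  rcases le_total 0 u with h | h
  · rw [wedgeArea_of_nonneg h]
    exact unitSphereArea_real_wedge hc hn hcn h ((le_abs_self u).trans huv) hv
  · rw [wedgeArea_of_nonpos h h0 hv]
    have h1 := unitSphereArea_split (cone c v) (wedgeNormal_ne_zero hc hn hcn u)
    have h2 := unitSphereArea_real_wedge hc (n := -n) (by rwa [norm_neg])
      (by rw [inner_neg_right, hcn, neg_zero]) (neg_nonneg.2 h) ((neg_le_abs u).trans huv) hv
    have e : -(Real.cos u • n - Real.sin u • c) =
        Real.cos (-u) • (-n) - Real.sin (-u) • c := by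
      rw [Real.cos_neg, Real.sin_neg]; module
    rw [unitSphereArea_real_cone hc h0 hv, e, h2] at h1
    linarith

/-- The intersection of two caps is cut by the great circle through the common points of their
boundaries into a part of the one cap and a part of the other. -/
theorem unitSphereArea_real_lens {c n : E3} (hc : ‖c‖ = 1) (hn : ‖n‖ = 1) (hcn : ⟪c, n⟫ = 0)
    {α β θ u : ℝ} (hα : α < Real.pi / 2) (hβ : β ≤ Real.pi / 2) (hθ : θ ∈ Ioo 0 Real.pi)
    (hu : |u| ≤ α) (hu' : |θ - u| ≤ β)
    (h : Real.cos β * Real.cos u = Real.cos α * Real.cos (θ - u)) :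
    unitSphereArea.real (cone c α ∩ cone (Real.cos θ • c + Real.sin θ • n) β) =
      wedgeArea u α + wedgeArea (θ - u) β := by
  set p := Real.cos θ • c + Real.sin θ • n with hp
  set w := Real.cos u • n - Real.sin u • c with hw
  have hpi := Real.pi_pos
  have hα0 : 0 ≤ α := (abs_nonneg u).trans hu
  have hβ0 : 0 ≤ β := (abs_nonneg _).trans hu'
  have hcα : 0 < Real.cos α := Real.cos_pos_of_mem_Ioo ⟨by linarith, hα⟩
  have hcβ : 0 ≤ Real.cos β := Real.cos_nonneg_of_neg_pi_div_two_le_of_le (by linarith) hβ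
  have hcu : 0 < Real.cos u :=
    Real.cos_pos_of_mem_Ioo ⟨by linarith [neg_abs_le u], by linarith [le_abs_self u]⟩
  have hsθ : 0 < Real.sin θ := Real.sin_pos_of_mem_Ioo hθ
  have hp1 : ‖p‖ = 1 := norm_combination_eq_one hc hn hcn (Real.cos_sq_add_sin_sq θ)
  -- By `h`, `cos α • p - cos β • c` is a positive multiple of `w`. So where `⟪w, x⟫ ≥ 0` the cap
  -- about `c` lies in the cap about `p`, and on the other side the inclusion is reversed if `cos β
  -- > 0`.
  have key : ∀ x : E3, Real.cos u * (Real.cos α * ⟪p, x⟫ - Real.cos β * ⟪c, x⟫) =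
      Real.cos α * Real.sin θ * ⟪w, x⟫ := by
    intro x
    simp only [hp, hw, inner_add_left, inner_sub_left, inner_smul_left, RCLike.conj_to_real]
    rw [Real.cos_sub] at h
    linear_combination (-⟪c, x⟫) * h
  have hpos : ∀ x : E3, 0 ≤ ⟪w, x⟫ → Real.cos β * ⟪c, x⟫ ≤ Real.cos α * ⟪p, x⟫ := by
    intro x hx
    have : 0 ≤ Real.cos u * (Real.cos α * ⟪p, x⟫ - Real.cos β * ⟪c, x⟫) := by
      rw [key]; positivity
    exact sub_nonneg.1 (nonneg_of_mul_nonneg_right this hcu)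
  have hneg : ∀ x : E3, ⟪w, x⟫ ≤ 0 → Real.cos α * ⟪p, x⟫ ≤ Real.cos β * ⟪c, x⟫ := by
    intro x hx
    have : 0 ≤ Real.cos u * (Real.cos β * ⟪c, x⟫ - Real.cos α * ⟪p, x⟫) := by
      have := mul_nonneg (mul_nonneg hcα.le hsθ.le) (neg_nonneg.2 hx)
      linarith [key x]
    exact sub_nonneg.1 (nonneg_of_mul_nonneg_right this hcu)
  rw [unitSphereArea_split _ (wedgeNormal_ne_zero hc hn hcn u)]
  congr 1
  · rw [← unitSphereArea_real_wedge_signed hc hn hcn hu hα.le]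
    congr 1
    ext x
    simp only [cone, halfSpace, mem_inter_iff, mem_ofPred_eq]
    refine ⟨fun hx => ⟨hx.1.1, hx.2⟩, fun hx => ⟨⟨hx.1, ?_⟩, hx.2⟩⟩
    have h1 := hpos x hx.2
    have h2 := mul_le_mul_of_nonneg_left hx.1 hcβ
    refine le_of_mul_le_mul_left ?_ hcα
    linarith
  -- `m` is the unit vector orthogonal to `p`, in the plane of `c` and `p`, on the side of `c`; seen
  -- from `p`, the chord is at distance `θ - u` in this direction.
  · set m := Real.sin θ • c + (-Real.cos θ) • n with hm
    have hm1 : ‖m‖ = 1 := norm_combination_eq_one hc hn hcn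
      (by rw [neg_sq, Real.sin_sq_add_cos_sq])
    have hnc : ⟪n, c⟫ = 0 := by rw [real_inner_comm, hcn]
    have hpm : ⟪p, m⟫ = 0 := by
      simp only [hp, hm, inner_add_left, inner_add_right, inner_smul_left, inner_smul_right, hcn,
        hnc, real_inner_self_eq_norm_sq, hc, hn, RCLike.conj_to_real]
      ring
    rw [← unitSphereArea_real_wedge_signed hp1 hm1 hpm hu' hβ]
    have e : Real.cos (θ - u) • m - Real.sin (θ - u) • p = -w := by
      rw [hm, hp, hw, Real.cos_sub, Real.sin_sub]
      have hs := Real.sin_sq_add_cos_sq θ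
      have e1 : Real.sin u = Real.sin u * (Real.sin θ ^ 2 + Real.cos θ ^ 2) := by rw [hs, mul_one]
      have e2 : Real.cos u = Real.cos u * (Real.sin θ ^ 2 + Real.cos θ ^ 2) := by rw [hs, mul_one]
      conv_rhs => rw [e1, e2]
      module
    rw [e]
    have hx' : ∀ x, x ∈ halfSpace (-w) → ⟪w, x⟫ ≤ 0 := fun x hx => by
      simpa [halfSpace, inner_neg_left] using hx
    -- If `β = π / 2`, division by `cos β` is impossible, but both sets then lie in the great circle
    -- orthogonal to `p`, which is null.
    rcases hcβ.eq_or_lt with h0 | h0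
    · have hnull : unitSphereArea (cone p β ∩ halfSpace (-w)) = 0 := by
        refine measure_mono_null ?_ (unitSphereArea_greatCircle
          (w := p) (by rw [← norm_ne_zero_iff, hp1]; exact one_ne_zero))
        intro x hx
        have h1 := hx.1
        have h2 := hneg x (hx' x hx.2)
        simp only [cone, mem_ofPred_eq, ← h0, zero_mul] at h1 h2 ⊢
        exact le_antisymm (nonpos_of_mul_nonpos_right h2 hcα) h1
      rw [measureReal_def, measureReal_def, hnull,
        measure_mono_null (inter_subset_inter_left _ inter_subset_right) hnull]
    · congr 1
      ext x
      refine ⟨fun hx => ⟨hx.1.2, hx.2⟩, fun hx => ⟨⟨?_, hx.1⟩, hx.2⟩⟩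
      have h1 := hneg x (hx' x hx.2)
      have h2 := mul_le_mul_of_nonneg_left hx.1 hcα.le
      simp only [cone, mem_ofPred_eq] at h1 h2 ⊢
      refine le_of_mul_le_mul_left ?_ h0
      linarith

/-! ### The position of the chord -/

/-- The signed distance from the center of the first of two caps of angles `α`, `β`, with centers
at distance `θ`, to the great circle through the common points of their boundaries. -/
noncomputable def chordAngle (α β θ : ℝ) : ℝ :=
  Real.arctan ((Real.cos β - Real.cos α * Real.cos θ) / (Real.cos α * Real.sin θ))

section chordAngle

variable {α β θ : ℝ}

theorem chordAngle_nonneg_iff (hα : α ∈ Ioo 0 (Real.pi / 2)) (hθ : θ ∈ Ioo 0 Real.pi) :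
    0 ≤ chordAngle α β θ ↔ Real.cos α * Real.cos θ ≤ Real.cos β := by
  have hcα : 0 < Real.cos α := Real.cos_pos_of_mem_Ioo ⟨by linarith [hα.1, Real.pi_pos], hα.2⟩
  have hsθ : 0 < Real.sin θ := Real.sin_pos_of_mem_Ioo hθ
  rw [chordAngle, Real.arctan_nonneg, le_div_iff₀ (by positivity), zero_mul, sub_nonneg]

theorem chordAngle_nonpos_iff (hα : α ∈ Ioo 0 (Real.pi / 2)) (hθ : θ ∈ Ioo 0 Real.pi) :
    chordAngle α β θ ≤ 0 ↔ Real.cos β ≤ Real.cos α * Real.cos θ := by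
  have hcα : 0 < Real.cos α := Real.cos_pos_of_mem_Ioo ⟨by linarith [hα.1, Real.pi_pos], hα.2⟩
  have hsθ : 0 < Real.sin θ := Real.sin_pos_of_mem_Ioo hθ
  rw [chordAngle, Real.arctan_le_zero, div_le_iff₀ (by positivity), zero_mul, sub_nonpos]

/-- This is the tangent formula with denominators cleared. Geometrically, a common boundary point at
distance `d` from the foot of the chord has `cos α = cos d cos u` and `cos β = cos d cos (θ - u)`;
elimination of `d` gives the equation. -/
theorem cos_mul_cos_chordAngle (hα : α ∈ Ioo 0 (Real.pi / 2)) (hθ : θ ∈ Ioo 0 Real.pi) :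
    Real.cos β * Real.cos (chordAngle α β θ) =
      Real.cos α * Real.cos (θ - chordAngle α β θ) := by
  have hcα : 0 < Real.cos α := Real.cos_pos_of_mem_Ioo ⟨by linarith [hα.1, Real.pi_pos], hα.2⟩
  have hsθ : 0 < Real.sin θ := Real.sin_pos_of_mem_Ioo hθ
  have hcu : 0 < Real.cos (chordAngle α β θ) := Real.cos_arctan_pos _
  have ht : Real.tan (chordAngle α β θ) =
      (Real.cos β - Real.cos α * Real.cos θ) / (Real.cos α * Real.sin θ) := Real.tan_arctan _
  rw [Real.tan_eq_sin_div_cos, div_eq_div_iff hcu.ne' (by positivity)] at ht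
  rw [Real.cos_sub]
  linear_combination -ht

/-- The triangle inequalities give `cos (α + θ) ≤ cos β ≤ cos (α - θ)`, and division by `cos α sin
θ` turns this into `|tan u| ≤ tan α`. -/
theorem abs_chordAngle_le (hα : α ∈ Ioo 0 (Real.pi / 2)) (hβ : 0 ≤ β) (hβ' : β ≤ Real.pi / 2)
    (hθ : θ ∈ Ioo 0 Real.pi) (h1 : |α - θ| ≤ β) (h2 : β ≤ α + θ) :
    |chordAngle α β θ| ≤ α := by
  have hpi := Real.pi_pos
  have hcα : 0 < Real.cos α := Real.cos_pos_of_mem_Ioo ⟨by linarith [hα.1], hα.2⟩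
  have hsθ : 0 < Real.sin θ := Real.sin_pos_of_mem_Ioo hθ
  have hle : Real.cos β ≤ Real.cos (α - θ) := by
    rw [← Real.cos_abs (α - θ)]
    exact Real.cos_le_cos_of_nonneg_of_le_pi (abs_nonneg _) (by linarith) h1
  have hge : Real.cos (α + θ) ≤ Real.cos β := by
    rcases le_total (α + θ) Real.pi with h | h
    · exact Real.cos_le_cos_of_nonneg_of_le_pi hβ h h2
    · rw [← Real.cos_two_pi_sub]
      exact Real.cos_le_cos_of_nonneg_of_le_pi hβ (by linarith) (by linarith [hα.2, hθ.2])
  rw [Real.cos_sub] at hle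
  rw [Real.cos_add] at hge
  have hatan : Real.arctan (Real.tan α) = α := Real.arctan_tan (by linarith [hα.1]) hα.2
  rw [abs_le]
  constructor
  · rw [chordAngle]
    refine le_of_eq_of_le (by rw [Real.arctan_neg, hatan] : -α = Real.arctan (-Real.tan α)) ?_
    refine Real.arctan_strictMono.monotone ?_
    rw [le_div_iff₀ (by positivity), Real.tan_eq_sin_div_cos]
    field_simp
    linarith
  · rw [chordAngle]
    refine le_of_le_of_eq ?_ hatan
    refine Real.arctan_strictMono.monotone ?_
    rw [div_le_iff₀ (by positivity), Real.tan_eq_sin_div_cos]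
    field_simp
    linarith

theorem abs_sub_chordAngle_le (hα : α ∈ Ioo 0 (Real.pi / 2)) (hβ : 0 ≤ β)
    (hβ' : β ≤ Real.pi / 2) (hθ : θ ∈ Ioo 0 Real.pi) (h1 : |α - θ| ≤ β) (h2 : β ≤ α + θ) :
    |θ - chordAngle α β θ| ≤ β := by
  have hpi := Real.pi_pos
  have hcα : 0 < Real.cos α := Real.cos_pos_of_mem_Ioo ⟨by linarith [hα.1], hα.2⟩
  have hcβ : 0 ≤ Real.cos β := Real.cos_nonneg_of_neg_pi_div_two_le_of_le (by linarith) hβ'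
  have hu := abs_chordAngle_le hα hβ hβ' hθ h1 h2
  have hE := cos_mul_cos_chordAngle (β := β) hα hθ
  set u := chordAngle α β θ
  have hcu : Real.cos α ≤ Real.cos u := by
    rw [← Real.cos_abs u]
    exact Real.cos_le_cos_of_nonneg_of_le_pi (abs_nonneg _) (by linarith [hα.2]) hu
  have hc : Real.cos β ≤ Real.cos (θ - u) := by
    refine le_of_mul_le_mul_left ?_ hcα
    rw [← hE, mul_comm]
    exact mul_le_mul_of_nonneg_left hcu hcβ
  have hu' := abs_le.1 hu
  by_contra! hlt
  rcases le_total |θ - u| Real.pi with h | h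
  · have := Real.cos_lt_cos_of_nonneg_of_le_pi hβ h hlt
    rw [Real.cos_abs] at this
    linarith
  -- Beyond `π` the cosine is no longer decreasing, but up to `3π / 2` it is negative, whereas `cos
  -- β ≥ 0`.
  · have h3 : |θ - u| < Real.pi + Real.pi / 2 := by
      rw [abs_lt]; constructor <;> linarith [hα.2, hθ.1, hθ.2]
    have := Real.cos_neg_of_pi_div_two_lt_of_lt (x := |θ - u|) (by linarith) h3
    rw [Real.cos_abs] at this
    linarith

end chordAngle

/-! ### `θ_min` as a chord angle, and the case analysis -/

/-- Valid also at `θ = π / 2`, where `tan` and `1 / tan` both take the value 0, in agreement with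
`cos θ / sin θ = 0`. -/
theorem div_sin_sub_one_div_tan {a b θ : ℝ} (hb : b ≠ 0) (hs : Real.sin θ ≠ 0) :
    a / (b * Real.sin θ) - 1 / Real.tan θ = (a - b * Real.cos θ) / (b * Real.sin θ) := by
  rw [Real.tan_eq_sin_div_cos, one_div_div]
  field_simp

theorem thetaMin₄_eq_chordAngle {γ θc θv : ℝ} (hc : Real.cos θc ≠ 0) (hs : Real.sin θv ≠ 0) :
    thetaMin₄ γ θc θv = chordAngle θc γ θv := by
  rw [thetaMin₄, chordAngle, div_sin_sub_one_div_tan hc hs]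

theorem thetaMin₃_eq_neg_chordAngle {γ θc θv : ℝ} (hc : Real.cos θc ≠ 0)
    (hs : Real.sin θv ≠ 0) : thetaMin₃ γ θc θv = -chordAngle θc γ θv := by
  rw [thetaMin₃, chordAngle, ← Real.arctan_neg, ← div_sin_sub_one_div_tan hc hs, neg_sub]

/-- Case 2 is Case 3 with the two caps exchanged: the chord is measured from the satellite. -/
theorem thetaMin₂_eq_neg_chordAngle {γ θc θv : ℝ} (hc : Real.cos γ ≠ 0)
    (hs : Real.sin θv ≠ 0) : thetaMin₂ γ θc θv = -chordAngle γ θc θv :=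
  thetaMin₃_eq_neg_chordAngle (γ := θc) (θc := γ) hc hs

theorem ae_unitSphereArea_norm_eq_one : ∀ᵐ x ∂unitSphereArea, ‖x‖ = 1 := by
  rw [unitSphereArea, ae_map_iff (by fun_prop) (measurableSet_eq_fun (by fun_prop) (by fun_prop))]
  exact ae_of_all _ fun x => by simp

theorem mem_cone_iff_angle_le {c x : E3} (hc : ‖c‖ = 1) (hx : ‖x‖ = 1) {v : ℝ} (h0 : 0 ≤ v)
    (hv : v ≤ Real.pi) : x ∈ cone c v ↔ InnerProductGeometry.angle c x ≤ v := by
  have h := InnerProductGeometry.cos_angle_mul_norm_mul_norm c x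
  rw [hc, hx, mul_one, mul_one] at h
  simp only [cone, mem_ofPred_eq, hx, mul_one, ← h]
  exact Real.strictAntiOn_cos.le_iff_ge ⟨h0, hv⟩
    ⟨InnerProductGeometry.angle_nonneg _ _, InnerProductGeometry.angle_le_pi _ _⟩

theorem exists_orthogonal_decomposition {c p : E3} (hc : ‖c‖ = 1) (hp : ‖p‖ = 1)
    (hθ : InnerProductGeometry.angle c p ∈ Ioo 0 Real.pi) :
    ∃ n : E3, ‖n‖ = 1 ∧ ⟪c, n⟫ = 0 ∧
      p = Real.cos (InnerProductGeometry.angle c p) • c +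
        Real.sin (InnerProductGeometry.angle c p) • n := by
  have h := InnerProductGeometry.cos_angle_mul_norm_mul_norm c p
  rw [hc, hp, mul_one, mul_one] at h
  set θ := InnerProductGeometry.angle c p
  have hs : 0 < Real.sin θ := Real.sin_pos_of_mem_Ioo hθ
  refine ⟨(Real.sin θ)⁻¹ • (p - Real.cos θ • c), ?_, ?_, ?_⟩
  · have h1 : ‖p - Real.cos θ • c‖ ^ 2 = Real.sin θ ^ 2 := by
      rw [norm_sub_sq_real, norm_smul, inner_smul_right, real_inner_comm, ← h, hc, hp, mul_one,
        Real.norm_eq_abs, sq_abs, Real.sin_sq]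
      ring
    rw [norm_smul, (sq_eq_sq₀ (norm_nonneg _) hs.le).1 h1, norm_inv, Real.norm_of_nonneg hs.le,
      inv_mul_cancel₀ hs.ne']
  · rw [inner_smul_right, inner_sub_right, inner_smul_right, real_inner_self_eq_norm_sq, hc, ← h]
    simp
  · rw [smul_smul, mul_inv_cancel₀ hs.ne', one_smul]
    abel

/-- This is the counterpart of `chordAngle_nonneg_iff` for the second center. It is not deduced by
exchanging the caps, since `β = π / 2` is allowed. If `u > θ`, then `cos u < cos θ cos (θ - u)`, and
multiplication by `cos β` contradicts the chord equation. -/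
theorem chordAngle_le {α β θ : ℝ} (hα : α ∈ Ioo 0 (Real.pi / 2)) (hβ : 0 ≤ β)
    (hβ' : β ≤ Real.pi / 2) (hθ : θ ∈ Ioo 0 Real.pi) (h1 : |α - θ| ≤ β) (h2 : β ≤ α + θ)
    (h : Real.cos β * Real.cos θ ≤ Real.cos α) : chordAngle α β θ ≤ θ := by
  have hpi := Real.pi_pos
  have hu := abs_le.1 (abs_chordAngle_le hα hβ hβ' hθ h1 h2)
  have hu' := abs_le.1 (abs_sub_chordAngle_le hα hβ hβ' hθ h1 h2)
  have hE := cos_mul_cos_chordAngle (β := β) hα hθ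
  set u := chordAngle α β θ
  by_contra! hlt
  have hcα : 0 < Real.cos α := Real.cos_pos_of_mem_Ioo ⟨by linarith [hα.1], hα.2⟩
  have hcu' : 0 < Real.cos (θ - u) :=
    Real.cos_pos_of_mem_Ioo ⟨by linarith [hα.2, hθ.1], by linarith⟩
  have hcu : 0 < Real.cos u := Real.cos_arctan_pos _
  have hcβ : 0 < Real.cos β := pos_of_mul_pos_left (hE ▸ mul_pos hcα hcu') hcu.le
  have hs : Real.sin (θ - u) < 0 := Real.sin_neg_of_neg_of_neg_pi_lt (by linarith) (by linarith)
  have hsθ : 0 < Real.sin θ := Real.sin_pos_of_mem_Ioo hθ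
  have hcos : Real.cos u = Real.cos θ * Real.cos (θ - u) + Real.sin θ * Real.sin (θ - u) := by
    rw [← Real.cos_sub]; congr 1; ring
  have h3 : Real.cos β * Real.cos u < Real.cos β * (Real.cos θ * Real.cos (θ - u)) := by
    refine mul_lt_mul_of_pos_left ?_ hcβ
    linarith [mul_neg_of_pos_of_neg hsθ hs]
  have h4 := mul_le_mul_of_nonneg_right h hcu'.le
  linarith

/-- The area of the intersection of two caps on the unit sphere, relative to that of the second. -/
theorem unitSphereArea_real_caps {c p : E3} (hc : ‖c‖ = 1) (hp : ‖p‖ = 1) {γ θc θv : ℝ}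
    (hθc : θc ∈ Ioo 0 (Real.pi / 2)) (hθv : θv = InnerProductGeometry.angle c p)
    (h0 : 0 ≤ γ) (h1 : θv - θc ≤ γ) (h2 : γ ≤ θc + θv) (h3 : γ ≤ Real.pi / 2) :
    unitSphereArea.real (cone c θc ∩ cone p γ) / (2 * Real.pi * (1 - Real.cos θc)) =
      centralAngleFormula γ θc θv := by
  have hpi := Real.pi_pos
  have hθ0 : 0 ≤ θv := hθv ▸ InnerProductGeometry.angle_nonneg _ _
  have hcc : 0 < Real.cos θc := Real.cos_pos_of_mem_Ioo ⟨by linarith [hθc.1], hθc.2⟩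
  have hcc1 : Real.cos θc < 1 := by
    have := Real.cos_lt_cos_of_nonneg_of_le_pi le_rfl (by linarith [hθc.2]) hθc.1
    rwa [Real.cos_zero] at this
  have hK : 1 - Real.cos θc ≠ 0 := by linarith
  have hcγ : 0 ≤ Real.cos γ := Real.cos_nonneg_of_neg_pi_div_two_le_of_le (by linarith) h3
  by_cases c1 : γ ≤ θc - θv
  · rw [centralAngleFormula, if_pos ⟨h0, c1⟩]
    have hsub : unitSphereArea.real (cone c θc ∩ cone p γ) = unitSphereArea.real (cone p γ) := by
      refine measureReal_congr (Filter.eventuallyEq_set.2 ?_)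
      filter_upwards [ae_unitSphereArea_norm_eq_one] with x hx
      rw [mem_inter_iff, mem_cone_iff_angle_le hc hx hθc.1.le (by linarith [hθc.2]),
        mem_cone_iff_angle_le hp hx h0 (by linarith)]
      refine ⟨fun h => h.2, fun h => ⟨?_, h⟩⟩
      have := InnerProductGeometry.angle_le_angle_add_angle c p x
      linarith
    rw [hsub, unitSphereArea_real_cone hp h0 h3]
    field_simp
  push Not at c1
  -- Outside Case 1 the centers are neither equal nor antipodal, so they span a plane.
  have hθ : θv ∈ Ioo 0 Real.pi := ⟨by by_contra! h; linarith, by linarith [hθc.2]⟩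
  have hsθ : Real.sin θv ≠ 0 := (Real.sin_pos_of_mem_Ioo hθ).ne'
  have habs : |θc - θv| ≤ γ := abs_le.2 ⟨by linarith, c1.le⟩
  obtain ⟨n, hn, hcn, hpn⟩ := exists_orthogonal_decomposition hc hp (hθv ▸ hθ)
  rw [← hθv] at hpn
  rw [centralAngleFormula, if_neg (fun h => absurd h.2 (not_le.2 c1))]
  by_cases c2 : θv < θc ∧ Real.cos θc ≤ Real.cos γ * Real.cos θv
  · rw [if_pos c2]
    have hγ0 : 0 < γ := by linarith [c2.1]
    have hγ2 : γ < Real.pi / 2 := by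
      refine lt_of_le_of_ne h3 fun h => ?_
      rw [h, Real.cos_pi_div_two, zero_mul] at c2
      linarith [c2.2]
    have hcγ' : 0 < Real.cos γ := Real.cos_pos_of_mem_Ioo ⟨by linarith, hγ2⟩
    have hγ : γ ∈ Ioo 0 (Real.pi / 2) := ⟨hγ0, hγ2⟩
    have g1 : |γ - θv| ≤ θc := abs_le.2 ⟨by linarith, by linarith⟩
    have g2 : θc ≤ γ + θv := by linarith
    have hu := abs_chordAngle_le hγ hθc.1.le hθc.2.le hθ g1 g2
    have hu' := abs_sub_chordAngle_le hγ hθc.1.le hθc.2.le hθ g1 g2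
    have hE := cos_mul_cos_chordAngle (β := θc) hγ hθ
    have hneg := (chordAngle_nonpos_iff (β := θc) hγ hθ).2 c2.2
    rw [thetaMin₂_eq_neg_chordAngle hcγ'.ne' hsθ]
    set u := chordAngle γ θc θv
    -- Here `u ≤ 0` is measured from the satellite, so the chord is at distance `θv - u = θv +
    -- θ_min` from the cell center, and the satellite's cap enters as a full cap minus a wedge.
    have hl := unitSphereArea_real_lens hc hn hcn (u := θv - u) hθc.2 h3 hθ hu'
      (by rwa [sub_sub_cancel]) (by rw [sub_sub_cancel, hE])
    rw [← hpn, sub_sub_cancel, wedgeArea_of_nonneg (by linarith [hθ.1]),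
      wedgeArea_of_nonpos hneg h0 h3] at hl
    rw [hl, ← sub_eq_add_neg]
    field_simp
    ring
  have hu := abs_chordAngle_le hθc h0 h3 hθ habs h2
  have hu' := abs_sub_chordAngle_le hθc h0 h3 hθ habs h2
  have hE := cos_mul_cos_chordAngle (β := γ) hθc hθ
  have hnonneg := chordAngle_nonneg_iff (β := γ) hθc hθ
  have hnonpos := chordAngle_nonpos_iff (β := γ) hθc hθ
  have hle := chordAngle_le hθc h0 h3 hθ habs h2
  rw [if_neg c2, thetaMin₃_eq_neg_chordAngle hcc.ne' hsθ, thetaMin₄_eq_chordAngle hcc.ne' hsθ]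
  set u := chordAngle θc γ θv
  have hl := unitSphereArea_real_lens hc hn hcn hθc.2 h3 hθ hu hu' hE
  rw [← hpn] at hl
  rw [hl]
  split_ifs with c3
  · have hu0 := hnonpos.2 c3.2
    rw [wedgeArea_of_nonpos hu0 hθc.1.le hθc.2.le, wedgeArea_of_nonneg (by linarith [hθ.1]),
      ← sub_eq_add_neg]
    field_simp
    ring
  -- In Case 4 the chord lies between the centers. The side conditions `θv < γ` and `θv < θc` of the
  -- earlier cases follow from the strict cosine inequalities, so failure of those cases yields `d1`
  -- and `d2`, that is, `0 ≤ u ≤ θv`.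
  · have d1 : Real.cos θc * Real.cos θv ≤ Real.cos γ := by
      by_contra! hlt
      refine c3 ⟨⟨?_, h2⟩, hlt.le⟩
      by_contra! hge
      have hcos : Real.cos θv ≤ Real.cos γ :=
        Real.cos_le_cos_of_nonneg_of_le_pi h0 hθ.2.le hge
      rcases le_total 0 (Real.cos θv) with hs | hs
      · linarith [mul_le_of_le_one_left hs hcc1.le]
      · linarith [mul_nonpos_of_nonneg_of_nonpos hcc.le hs]
    have d2 : Real.cos γ * Real.cos θv ≤ Real.cos θc := by
      by_contra! hlt
      refine c2 ⟨?_, hlt.le⟩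
      by_contra! hge
      have hcos : Real.cos θv ≤ Real.cos θc :=
        Real.cos_le_cos_of_nonneg_of_le_pi hθc.1.le hθ.2.le hge
      rcases le_total 0 (Real.cos θv) with hs | hs
      · linarith [mul_le_of_le_one_left hs (Real.cos_le_one γ)]
      · linarith [mul_nonpos_of_nonneg_of_nonpos hcγ hs]
    rw [wedgeArea_of_nonneg (hnonneg.2 d1), wedgeArea_of_nonneg (by linarith [hle d2])]
    field_simp

/-! ### Passage to radius `r` and to the uniform law -/

theorem sphereArea_real {r : ℝ} {A : Set E3} (hA : MeasurableSet A) :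
    (sphereArea r).real A = r ^ 2 * unitSphereArea.real ((fun x : E3 => r • x) ⁻¹' A) := by
  have hm : Measurable fun x : E3 => r • x := measurable_const_smul r
  have : (fun x : Metric.sphere (0 : E3) 1 => r • (x : E3)) = (fun x : E3 => r • x) ∘ Subtype.val :=
    rfl
  rw [sphereArea, this, ← Measure.map_map hm measurable_subtype_coe, measureReal_ennreal_smul_apply,
    ENNReal.toReal_ofReal (sq_nonneg r), map_measureReal_apply hm hA]
  rfl

instance (r : ℝ) : IsFiniteMeasure (sphereArea r) := by
  unfold sphereArea
  exact Measure.smul_finite _ ENNReal.ofReal_ne_top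

theorem measurable_angle (c : E3) : Measurable fun x : E3 => InnerProductGeometry.angle c x := by
  have := Real.continuous_arccos.measurable
  unfold InnerProductGeometry.angle
  fun_prop

theorem measurableSet_sphericalCap (r : ℝ) (c : E3) (θ : ℝ) :
    MeasurableSet (sphericalCap r c θ) :=
  Metric.isClosed_sphere.measurableSet.inter
    (measurableSet_le (measurable_angle c) measurable_const)

theorem smul_mem_sphericalCap_iff {r : ℝ} (hr : 0 < r) {c x : E3} (hc : ‖c‖ = r) (hx : ‖x‖ = 1)
    {v : ℝ} (h0 : 0 ≤ v) (hv : v ≤ Real.pi) :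
    r • x ∈ sphericalCap r c v ↔ x ∈ cone (r⁻¹ • c) v := by
  rw [mem_cone_iff_angle_le (by rw [norm_smul, hc, norm_inv, Real.norm_of_nonneg hr.le,
    inv_mul_cancel₀ hr.ne']) hx h0 hv, InnerProductGeometry.angle_smul_left_of_pos _ _ (inv_pos.2 hr)]
  simp [sphericalCap, norm_smul, hx, abs_of_pos hr,
    InnerProductGeometry.angle_smul_right_of_pos _ _ hr]

theorem sphereArea_real_cap {r : ℝ} (hr : 0 < r) {c : E3} (hc : ‖c‖ = r) {v : ℝ} (h0 : 0 ≤ v)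
    (hv : v ≤ Real.pi / 2) :
    (sphereArea r).real (sphericalCap r c v) = 2 * Real.pi * r ^ 2 * (1 - Real.cos v) := by
  have hc1 : ‖r⁻¹ • c‖ = 1 := by
    rw [norm_smul, hc, norm_inv, Real.norm_of_nonneg hr.le, inv_mul_cancel₀ hr.ne']
  rw [sphereArea_real (measurableSet_sphericalCap r c v),
    measureReal_congr (t := cone (r⁻¹ • c) v), unitSphereArea_real_cone hc1 h0 hv]
  · ring
  · refine Filter.eventuallyEq_set.2 ?_
    filter_upwards [ae_unitSphereArea_norm_eq_one] with x hx
    exact smul_mem_sphericalCap_iff hr hc hx h0 (by linarith [Real.pi_pos])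

theorem sphereArea_real_inter_caps {r : ℝ} (hr : 0 < r) {c p : E3} (hc : ‖c‖ = r) (hp : ‖p‖ = r)
    {v γ : ℝ} (h0 : 0 ≤ v) (hv : v ≤ Real.pi) (hγ0 : 0 ≤ γ) (hγ : γ ≤ Real.pi) :
    (sphereArea r).real (sphericalCap r p γ ∩ sphericalCap r c v) =
      r ^ 2 * unitSphereArea.real (cone (r⁻¹ • c) v ∩ cone (r⁻¹ • p) γ) := by
  rw [sphereArea_real
    ((measurableSet_sphericalCap r p γ).inter (measurableSet_sphericalCap r c v))]
  congr 1
  refine measureReal_congr (Filter.eventuallyEq_set.2 ?_)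
  filter_upwards [ae_unitSphereArea_norm_eq_one] with x hx
  rw [mem_preimage, mem_inter_iff, smul_mem_sphericalCap_iff hr hp hx hγ0 hγ,
    smul_mem_sphericalCap_iff hr hc hx h0 hv, and_comm, mem_inter_iff]

/-- The distribution function of the angle to `q` of a uniform point of a measurable subset of
positive area of a sphere. -/
theorem cdf_angle_of_isUniform {Ω : Type*} [MeasurableSpace Ω] (ℙ : Measure Ω)
    [IsProbabilityMeasure ℙ] {r : ℝ} {s : Set E3} (hs : MeasurableSet s)
    (hpos : 0 < (sphereArea r).real s) {X : Ω → E3}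
    (hX : pdf.IsUniform X s ℙ (sphereArea r)) (q : E3) (γ : ℝ) :
    ProbabilityTheory.cdf (ℙ.map fun ω => InnerProductGeometry.angle q (X ω)) γ =
      (sphereArea r).real (s ∩ {x | InnerProductGeometry.angle q x ≤ γ}) /
        (sphereArea r).real s := by
  have hne : sphereArea r s ≠ 0 := fun h => by simp [measureReal_def, h] at hpos
  -- Measurability of `X` is not assumed: otherwise `ℙ.map X` would be zero, unlike the uniform law
  -- on a set of positive finite area.
  have hXm : AEMeasurable X ℙ := hX.aemeasurable hne (measure_ne_top _ _)
  have hm := measurable_angle q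
  have hY : AEMeasurable (fun ω => InnerProductGeometry.angle q (X ω)) ℙ := hm.comp_aemeasurable hXm
  have := Measure.isProbabilityMeasure_map (μ := ℙ) hY
  have hmap : ℙ.map (fun ω => InnerProductGeometry.angle q (X ω)) =
      (ℙ.map X).map fun x => InnerProductGeometry.angle q x :=
    (AEMeasurable.map_map_of_aemeasurable hm.aemeasurable hXm).symm
  rw [ProbabilityTheory.cdf_eq_real, hmap, map_measureReal_apply hm measurableSet_Iic, hX,
    measureReal_def, ProbabilityTheory.cond_apply hs, ENNReal.toReal_mul, ENNReal.toReal_inv,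
    div_eq_inv_mul]
  rfl

end SphericalCell

theorem lemma3 {Ω : Type*} [MeasurableSpace Ω] (ℙ : Measure Ω) [IsProbabilityMeasure ℙ]
    -- Earth radius, altitude, cell center, satellite position and half-width of the cell
    (r h θc θv : ℝ) (C Q : SphericalCell.E3)
    (hr : 0 < r) (hh : 0 < h)
    (hC : C ∈ Metric.sphere (0 : SphericalCell.E3) r) (hQ : ‖Q‖ = r + h)
    (hθc : 0 < θc) (hθc' : θc < Real.pi / 2)
    (hθv : θv = InnerProductGeometry.angle C (SphericalCell.groundProjection r Q))
    -- the user is uniformly distributed in the cell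
    (X : Ω → SphericalCell.E3)
    (hX : pdf.IsUniform X (SphericalCell.sphericalCap r C θc) ℙ (SphericalCell.sphereArea r))
    -- its central angle to the satellite
    (Υ : Ω → ℝ) (hΥ : Υ = fun ω => InnerProductGeometry.angle Q (X ω)) :
    (∀ γ : ℝ, ProbabilityTheory.cdf (ℙ.map Υ) γ =
      (SphericalCell.sphereArea r).real
          (SphericalCell.sphericalCap r (SphericalCell.groundProjection r Q) γ ∩
            SphericalCell.sphericalCap r C θc) /
        (2 * Real.pi * r ^ 2 * (1 - Real.cos θc))) ∧
    (∀ γ : ℝ, γ < max 0 (θv - θc) → ProbabilityTheory.cdf (ℙ.map Υ) γ = 0) ∧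
    (∀ γ : ℝ, max 0 (θv - θc) ≤ γ → γ ≤ θc + θv → γ ≤ Real.pi / 2 →
      ProbabilityTheory.cdf (ℙ.map Υ) γ = SphericalCell.centralAngleFormula γ θc θv) ∧
    (∀ γ : ℝ, θc + θv < γ → ProbabilityTheory.cdf (ℙ.map Υ) γ = 1) := by
  have hpi := Real.pi_pos
  have hCr : ‖C‖ = r := by simpa using hC
  have hQ0 : 0 < ‖Q‖ := by rw [hQ]; linarith
  have hrQ : 0 < r / ‖Q‖ := div_pos hr hQ0
  have hangle : ∀ x, InnerProductGeometry.angle (SphericalCell.groundProjection r Q) x =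
      InnerProductGeometry.angle Q x := fun x =>
    InnerProductGeometry.angle_smul_left_of_pos _ _ hrQ
  have hP : ‖SphericalCell.groundProjection r Q‖ = r := by
    rw [SphericalCell.groundProjection, norm_smul, Real.norm_of_nonneg hrQ.le,
      div_mul_cancel₀ _ hQ0.ne']
  set P := SphericalCell.groundProjection r Q
  have harea := SphericalCell.sphereArea_real_cap hr hCr hθc.le hθc'.le
  have hcc1 : Real.cos θc < 1 := by
    have := Real.cos_lt_cos_of_nonneg_of_le_pi le_rfl (by linarith) hθc
    rwa [Real.cos_zero] at this
  have hK : 0 < 1 - Real.cos θc := by linarith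
  have hpos : 0 < 2 * Real.pi * r ^ 2 * (1 - Real.cos θc) := by positivity
  have hcdf : ∀ γ : ℝ, ProbabilityTheory.cdf (ℙ.map Υ) γ =
      (SphericalCell.sphereArea r).real
          (SphericalCell.sphericalCap r P γ ∩ SphericalCell.sphericalCap r C θc) /
        (2 * Real.pi * r ^ 2 * (1 - Real.cos θc)) := by
    intro γ
    rw [hΥ, SphericalCell.cdf_angle_of_isUniform ℙ (SphericalCell.measurableSet_sphericalCap r C θc)
      (harea ▸ hpos) hX, harea]
    -- Membership in the cell already places `x` on the sphere, so the cap about `P` adds only the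
    -- angle condition.
    congr 2
    ext x
    simp only [SphericalCell.sphericalCap, mem_inter_iff, mem_ofPred_eq, hangle]
    tauto
  refine ⟨hcdf, fun γ hγ => ?_, fun γ h1 h2 h3 => ?_, fun γ hγ => ?_⟩
  · have hempty : SphericalCell.sphericalCap r P γ ∩ SphericalCell.sphericalCap r C θc = ∅ := by
      refine eq_empty_of_forall_notMem fun x hx => ?_
      have h1 : InnerProductGeometry.angle P x ≤ γ := hx.1.2
      have h2 : InnerProductGeometry.angle C x ≤ θc := hx.2.2
      rcases lt_max_iff.1 hγ with h | h
      · linarith [InnerProductGeometry.angle_nonneg P x]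
      · have := InnerProductGeometry.angle_le_angle_add_angle C x P
        rw [InnerProductGeometry.angle_comm x P] at this
        linarith
    rw [hcdf, hempty, measureReal_empty, zero_div]
  · have h0 : 0 ≤ γ := (le_max_left _ _).trans h1
    have hunit : ∀ y : SphericalCell.E3, ‖y‖ = r → ‖r⁻¹ • y‖ = 1 := fun y hy => by
      rw [norm_smul, hy, norm_inv, Real.norm_of_nonneg hr.le, inv_mul_cancel₀ hr.ne']
    rw [hcdf, SphericalCell.sphereArea_real_inter_caps hr hCr hP hθc.le (by linarith) h0
      (by linarith), ← SphericalCell.unitSphereArea_real_caps (hunit C hCr) (hunit P hP)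
      ⟨hθc, hθc'⟩ ?_ h0 ((le_max_right _ _).trans h1) h2 h3]
    · field_simp
    · rw [hθv, InnerProductGeometry.angle_smul_left_of_pos _ _ (inv_pos.2 hr),
        InnerProductGeometry.angle_smul_right_of_pos _ _ (inv_pos.2 hr)]
  · have hsub : SphericalCell.sphericalCap r P γ ∩ SphericalCell.sphericalCap r C θc =
        SphericalCell.sphericalCap r C θc := by
      refine inter_eq_right.2 fun x hx => ⟨hx.1, ?_⟩
      have h2 : InnerProductGeometry.angle C x ≤ θc := hx.2
      have := InnerProductGeometry.angle_le_angle_add_angle P C x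
      rw [InnerProductGeometry.angle_comm P C] at this
      linarith
    rw [hcdf, hsub, harea, div_self hpos.ne']
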